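/- Let $n\ge 0$ be an integer, $[n]=\{1,\dots,n\}$, $S_n$ the group of permutations of $[n]$, and for a finite set $E$ let $L(E)$ be the real vector space of functions $E\to\mathbb{R}$. An injective word over $[n]$ is a finite sequence $\omega=\omega_1\cdots\omega_k$ ($0\le k\le n$) of distinct elements of $[n]$; its content is $c(\omega)=\{\omega_1,\dots,\omega_k\}$. Let $\Gamma_n$ be the set of all injective words over $[n]$, and for $A\subseteq[n]$ let $\Gamma(A)$ be the set of those with content $A$; $L(\Gamma(A))$ is regarded as the subspace of $L(\Gamma_n)$ of functions vanishing outside $\Gamma(A)$. A permutation $\sigma\in S_n$ is identified with the word $\sigma^{-1}(1)\sigma^{-1}(2)\cdots\sigma^{-1}(n)\in\Gamma([n])$. Write $\delta_\omega$ for the Dirac function of a word $\omega$. For $a\in[n]$ let the deletion operator $\varrho_a:L(\Gamma_n)\to L(\Gamma_n)$ be the linear map with $\varrho_a\delta_\omega=\delta_{\omega\setminus\{a\}}$, where $\omega\setminus\{a\}$ is $\omega$ with the letter $a$ removed if $a\in c(\omega)$, and is $\omega$ otherwise. For $A\subseteq[n]$ put $$H_A=\{x\in L(\Gamma(A)) :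 \varrho_a x=0 \text{ for all } a\in A\}.$$ Let $\phi_n:L(\Gamma_n)\to L(S_n)$ be the linear map sending $\delta_\omega$ to the indicator function of the set of those $\sigma\in S_n$ whose word contains $\omega$ as a contiguous subword, and put $W_A=\phi_n(H_A)$. Let $V^0\subseteq L(S_n)$ be the subspace of constant functions. **Theorem (Multiresolution decomposition).** $L(S_n)$ is the internal direct sum $$L(S_n)=V^0\oplus\bigoplus_{A\subseteq[n],\ |A|\ge 2}W_A.$$ Moreover, for every $A\subseteq[n]$ with $|A|\ge2$, $\dim W_A=d_{|A|}$, where $d_k$ is the number of permutations of $\{1,\dots,k\}$ without fixed points, $\phi_n(H_A)=W_A$, and the restriction of $\phi_n$ to $H_A$ is injective. -/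

import Mathlib

namespace MRA

/-- Injective words over the alphabet `Fin n`: lists of distinct letters (including the empty word). -/
abbrev InjWord (n : ℕ) : Type := {l : List (Fin n) // l.Nodup}

/-- The content of a word: the set of its letters. -/
def content {n : ℕ} (w : InjWord n) : Finset (Fin n) := w.1.toFinset

/-- The injective word obtained by deleting the letter `a`
(the word is unchanged if `a` does not occur in it). -/
def deleteLetter {n : ℕ} (a : Fin n) (w : InjWord n) : InjWord n :=
  ⟨w.1.erase a, w.2.erase a⟩

/-- The full ranking `σ⁻¹(1) σ⁻¹(2) ⋯ σ⁻¹(n)` as an injective word; the permutation `σ` maps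
an item to its rank. -/
def permWord {n : ℕ} (σ : Equiv.Perm (Fin n)) : InjWord n :=
  ⟨List.ofFn σ.symm, List.nodup_ofFn.2 σ.symm.injective⟩

/-- Chains: real-valued functions on the set of injective words. -/
abbrev Chain (n : ℕ) : Type := InjWord n → ℝ

/-- `L(S_n)`: real-valued functions on the symmetric group. -/
abbrev PermFun (n : ℕ) : Type := Equiv.Perm (Fin n) → ℝ

/-- The deletion operator: the linear operator sending the Dirac function of a word
to the Dirac function of that word with the letter `a` deleted. -/
noncomputable def deletion {n : ℕ} (a : Fin n) : Chain n →ₗ[ℝ] Chain n :=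
  (Pi.basisFun ℝ (InjWord n)).constr ℝ fun w => Pi.single (deleteLetter a w) 1

/-- The embedding operator `φ_n`: the linear operator sending the Dirac function of a word `w` to
the indicator function of the set of permutations whose word contains `w` as a contiguous subword
(`w <:+: v` says that `w` is an infix of `v`). -/
noncomputable def phi (n : ℕ) : Chain n →ₗ[ℝ] PermFun n :=
  (Pi.basisFun ℝ (InjWord n)).constr ℝ fun w =>
    Set.indicator {σ : Equiv.Perm (Fin n) | w.1 <:+: (permWord σ).1} 1

/-- The chains on words with content `A`, seen as chains on all injective words
that vanish on the words of a different content. -/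
def chainsOn {n : ℕ} (A : Finset (Fin n)) : Submodule ℝ (Chain n) where
  carrier := {x | ∀ w : InjWord n, content w ≠ A → x w = 0}
  zero_mem' := fun _ _ => rfl
  add_mem' := fun {x y} hx hy w hw => by simp [hx w hw, hy w hw]
  smul_mem' := fun c x hx w hw => by simp [hx w hw]

/-- `H_A`: the chains on words with content `A` killed by the deletion of every letter of `A`. -/
noncomputable def H {n : ℕ} (A : Finset (Fin n)) : Submodule ℝ (Chain n) :=
  chainsOn A ⊓ ⨅ a ∈ A, LinearMap.ker (deletion a)

/-- `W_A`, the image of `H_A` under `φ_n`. -/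
noncomputable def W {n : ℕ} (A : Finset (Fin n)) : Submodule ℝ (PermFun n) :=
  (H A).map (phi n)

/-- `V⁰`: the constant functions on the symmetric group. -/
def V0 (n : ℕ) : Submodule ℝ (PermFun n) := Submodule.span ℝ {1}

/-- The components of the decomposition: `none` stands for the constant functions, and
`some A` for `W_A`, where `A` has at least two elements. -/
noncomputable def component (n : ℕ) :
    Option {A : Finset (Fin n) // 2 ≤ A.card} → Submodule ℝ (PermFun n)
  | none => V0 n
  | some A => W A.1

end MRA

namespace MRA

variable {n : ℕ}

/-! The `W A`, for all sets `A`, are independent by triangularity, and a dimension count then shows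
that they fill the space. Triangularity comes from the marginals at words `π` of content `A`. They
vanish on `W B` unless `B ⊆ A` (`marginal_phi_eq_zero`), while on chains of content `A` the marginal
of `phi n x` is a nonzero multiple of `x π` (`marginal_phi_of_mem_chainsOn`). This also gives
injectivity of `phi n` on each `H A`. For the count, rank-nullity for one deletion after another
computes `dim H A` by inclusion-exclusion as the derangement number of `A.card` (`finrank_H`).
Sorting permutations by support shows that these numbers add up to `n!`. The empty set accounts for
the constants, and singletons contribute nothing. -/

theorem deletion_single (a : Fin n) (w : InjWord n) :
    deletion a (Pi.single w 1) = Pi.single (deleteLetter a w) 1 := by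
  rw [deletion, ← Pi.basisFun_apply, Module.Basis.constr_basis]

theorem phi_single (w : InjWord n) :
    phi n (Pi.single w 1) =
      Set.indicator {σ : Equiv.Perm (Fin n) | w.1 <:+: (permWord σ).1} 1 := by
  rw [phi, ← Pi.basisFun_apply, Module.Basis.constr_basis]

theorem chain_hom_ext {M : Type*} [AddCommMonoid M] [Module ℝ M] {f g : Chain n →ₗ[ℝ] M}
    (h : ∀ w, f (Pi.single w 1) = g (Pi.single w 1)) : f = g :=
  (Pi.basisFun ℝ (InjWord n)).ext fun w => by simpa using h w

theorem chain_eq_sum (x : Chain n) : x = ∑ w, x w • (Pi.single w 1 : Chain n) := by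
  simpa using ((Pi.basisFun ℝ (InjWord n)).sum_repr x).symm

/-- A chain in `chainsOn A` is a linear combination of the Dirac functions of words
with content `A`. -/
theorem map_mem_of_mem_chainsOn {M : Type*} [AddCommMonoid M] [Module ℝ M]
    (f : Chain n →ₗ[ℝ] M) {p : Submodule ℝ M} {A : Finset (Fin n)} {x : Chain n}
    (hx : x ∈ chainsOn A) (h : ∀ w, content w = A → f (Pi.single w 1) ∈ p) : f x ∈ p := by
  rw [chain_eq_sum x, map_sum]
  refine Submodule.sum_mem _ fun w _ => ?_
  rw [map_smul]
  by_cases hw : content w = A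
  · exact p.smul_mem _ (h w hw)
  · simp [hx w hw]

theorem map_eq_map_of_mem_chainsOn {M : Type*} [AddCommMonoid M] [Module ℝ M]
    (f g : Chain n →ₗ[ℝ] M) {A : Finset (Fin n)} {x : Chain n}
    (hx : x ∈ chainsOn A) (h : ∀ w, content w = A → f (Pi.single w 1) = g (Pi.single w 1)) :
    f x = g x := by
  rw [chain_eq_sum x, map_sum, map_sum]
  refine Finset.sum_congr rfl fun w _ => ?_
  rw [map_smul, map_smul]
  by_cases hw : content w = A
  · rw [h w hw]
  · simp [hx w hw]

theorem single_mem_chainsOn (w : InjWord n) : Pi.single w 1 ∈ chainsOn (content w) := by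
  intro v hv
  have : v ≠ w := by rintro rfl; exact hv rfl
  simp [this]

theorem content_deleteLetter (a : Fin n) (w : InjWord n) :
    content (deleteLetter a w) = (content w).erase a := by
  ext b
  simp [content, deleteLetter, w.2.mem_erase_iff]

theorem deletion_mem_chainsOn (a : Fin n) {A : Finset (Fin n)} {x : Chain n}
    (hx : x ∈ chainsOn A) : deletion a x ∈ chainsOn (A.erase a) := by
  refine map_mem_of_mem_chainsOn _ hx fun w hw => ?_
  rw [deletion_single, ← hw, ← content_deleteLetter]
  exact single_mem_chainsOn _

theorem deletion_comm (a b : Fin n) (x : Chain n) :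
    deletion a (deletion b x) = deletion b (deletion a x) := by
  have : deletion a ∘ₗ deletion b = deletion b ∘ₗ deletion a := by
    refine chain_hom_ext fun w => ?_
    simp only [LinearMap.comp_apply, deletion_single, deleteLetter, List.erase_comm]
  exact LinearMap.congr_fun this x

/-! ### Dimension of `H A` -/

/-- The operator prepending the letter `a` to the words that do not contain it, and killing the
other words. -/
noncomputable def prepend (a : Fin n) : Chain n →ₗ[ℝ] Chain n :=
  (Pi.basisFun ℝ (InjWord n)).constr ℝ fun w =>
    if h : a ∈ w.1 then 0 else Pi.single ⟨a :: w.1, List.nodup_cons.2 ⟨h, w.2⟩⟩ 1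

theorem prepend_single (a : Fin n) (w : InjWord n) :
    prepend a (Pi.single w 1) =
      if h : a ∈ w.1 then 0 else Pi.single ⟨a :: w.1, List.nodup_cons.2 ⟨h, w.2⟩⟩ 1 := by
  rw [prepend, ← Pi.basisFun_apply, Module.Basis.constr_basis]

theorem prepend_mem_chainsOn {a : Fin n} {A : Finset (Fin n)} {x : Chain n}
    (hx : x ∈ chainsOn A) : prepend a x ∈ chainsOn (insert a A) := by
  refine map_mem_of_mem_chainsOn _ hx fun w hw => ?_
  rw [prepend_single]
  split_ifs with h
  · exact Submodule.zero_mem _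
  · rw [← hw]
    convert single_mem_chainsOn _ using 1
    simp [content]

theorem deletion_prepend_self {a : Fin n} {A : Finset (Fin n)} (ha : a ∉ A) {x : Chain n}
    (hx : x ∈ chainsOn A) : deletion a (prepend a x) = x := by
  refine map_eq_map_of_mem_chainsOn (deletion a ∘ₗ prepend a) LinearMap.id hx fun w hw => ?_
  have h : a ∉ w.1 := by simpa [← hw, content] using ha
  simp [prepend_single, h, deletion_single, deleteLetter]

theorem deletion_prepend_of_ne {a b : Fin n} (hab : a ≠ b) (x : Chain n) :
    deletion b (prepend a x) = prepend a (deletion b x) := by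
  have : deletion b ∘ₗ prepend a = prepend a ∘ₗ deletion b := by
    refine chain_hom_ext fun w => ?_
    simp only [LinearMap.comp_apply, prepend_single, deletion_single, deleteLetter,
      List.mem_erase_of_ne hab]
    split_ifs
    · simp
    · simp [deletion_single, deleteLetter, hab]
  exact LinearMap.congr_fun this x

/-- The chains on words with content `A` killed by the deletion of every letter of `J`. -/
noncomputable def killed (J A : Finset (Fin n)) : Submodule ℝ (Chain n) :=
  chainsOn A ⊓ ⨅ a ∈ J, LinearMap.ker (deletion a)

theorem mem_killed {J A : Finset (Fin n)} {x : Chain n} :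
    x ∈ killed J A ↔ x ∈ chainsOn A ∧ ∀ a ∈ J, deletion a x = 0 := by
  simp [killed]

/-- Prepending `a` is a right inverse of the deletion of `a` on words without `a`, and it commutes
with the other deletions, so it preserves the conditions imposed by `J`. -/
theorem map_deletion_killed {J A : Finset (Fin n)} {a : Fin n} (ha : a ∈ A) (haJ : a ∉ J) :
    (killed J A).map (deletion a) = killed J (A.erase a) := by
  ext y
  simp only [Submodule.mem_map, mem_killed]
  constructor
  · rintro ⟨x, ⟨hx, hxJ⟩, rfl⟩
    exact ⟨deletion_mem_chainsOn a hx, fun b hb => by rw [deletion_comm, hxJ b hb, map_zero]⟩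
  · rintro ⟨hy, hyJ⟩
    refine ⟨prepend a y, ⟨?_, fun b hb => ?_⟩, deletion_prepend_self (A.notMem_erase a) hy⟩
    · simpa [Finset.insert_erase ha] using prepend_mem_chainsOn (a := a) hy
    · rw [deletion_prepend_of_ne (by rintro rfl; exact haJ hb), hyJ b hb, map_zero]

theorem killed_inf_ker_deletion (J A : Finset (Fin n)) (a : Fin n) :
    killed J A ⊓ LinearMap.ker (deletion a) = killed (insert a J) A := by
  ext x
  simp only [Submodule.mem_inf, mem_killed, LinearMap.mem_ker, Finset.forall_mem_insert]
  tauto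

/-- Rank-nullity for `deletion a` on `killed J A`, whose image and kernel are again spaces of this
kind. -/
theorem finrank_killed_insert {J A : Finset (Fin n)} {a : Fin n} (ha : a ∈ A) (haJ : a ∉ J) :
    Module.finrank ℝ (killed J (A.erase a)) + Module.finrank ℝ (killed (insert a J) A) =
      Module.finrank ℝ (killed J A) := by
  rw [← map_deletion_killed ha haJ, ← killed_inf_ker_deletion, ← Submodule.map_comap_subtype,
    Submodule.finrank_map_subtype_eq, ← LinearMap.range_domRestrict, ← LinearMap.ker_domRestrict]
  exact LinearMap.finrank_range_add_finrank_ker _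

theorem card_words_with_content (A : Finset (Fin n)) :
    Fintype.card {w : InjWord n // content w = A} = A.card.factorial := by
  rw [← Finset.length_toList, ← List.length_permutations,
    ← List.toFinset_card_of_nodup (List.nodup_permutations_iff.2 A.nodup_toList),
    Fintype.card_subtype]
  refine Finset.card_bij (fun w _ => w.1) (fun w hw => ?_) (fun _ _ _ _ h => Subtype.ext h)
    fun l hl => ?_
  · simp only [Finset.mem_filter, Finset.mem_univ, true_and] at hw
    simp only [List.mem_toFinset, List.mem_permutations]
    rw [List.perm_ext_iff_of_nodup w.2 A.nodup_toList]
    simp [← hw, content]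
  · simp only [List.mem_toFinset, List.mem_permutations] at hl
    refine ⟨⟨l, hl.nodup_iff.2 A.nodup_toList⟩, ?_, rfl⟩
    rw [Finset.mem_filter]
    exact ⟨Finset.mem_univ _, by simp [content, List.toFinset_eq_of_perm _ _ hl]⟩

/-- Chains on words with content `A` are the functions on the set of these words. -/
noncomputable def chainsOnEquiv (A : Finset (Fin n)) :
    chainsOn A ≃ₗ[ℝ] ({w : InjWord n // content w = A} → ℝ) where
  toFun x w := x.1 w.1
  map_add' _ _ := rfl
  map_smul' _ _ := rfl
  invFun f := ⟨fun w => if h : content w = A then f ⟨w, h⟩ else 0, fun w hw => by simp [hw]⟩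
  left_inv x := by
    ext w
    by_cases h : content w = A
    · simp [h]
    · simp [h, x.2 w h]
  right_inv f := by
    ext w
    simp [w.2]

theorem finrank_killed_empty (A : Finset (Fin n)) :
    Module.finrank ℝ (killed ∅ A) = A.card.factorial := by
  have : killed ∅ A = chainsOn A := by ext; simp [mem_killed]
  rw [this, (chainsOnEquiv A).finrank_eq, Module.finrank_fintype_fun_eq_card,
    card_words_with_content]

theorem finrank_killed (J : Finset (Fin n)) : ∀ {A : Finset (Fin n)}, J ⊆ A →
    (Module.finrank ℝ (killed J A) : ℤ) =
      ∑ T ∈ J.powerset, (-1) ^ T.card * ((A.card - T.card).factorial : ℤ) := by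
  induction J using Finset.induction_on with
  | empty => intro A _; simp [finrank_killed_empty]
  | insert a J haJ ih =>
    intro A hA
    obtain ⟨ha, hJ⟩ := Finset.insert_subset_iff.1 hA
    have h := finrank_killed_insert ha haJ
    have h1 := ih hJ
    have h2 := ih (A := A.erase a) fun b hb =>
      Finset.mem_erase.2 ⟨by rintro rfl; exact haJ hb, hJ hb⟩
    rw [Finset.sum_powerset_insert haJ, ← h1, ← h]
    -- The terms of the subsets containing `a` are, up to sign, those of the formula for `A.erase
    -- a`.
    have h3 : ∑ T ∈ J.powerset, (-1) ^ (insert a T).card *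
        ((A.card - (insert a T).card).factorial : ℤ) =
          -(Module.finrank ℝ (killed J (A.erase a)) : ℤ) := by
      rw [h2, ← Finset.sum_neg_distrib]
      refine Finset.sum_congr rfl fun T hT => ?_
      rw [Finset.card_insert_of_notMem fun h => haJ (Finset.mem_powerset.1 hT h),
        Finset.card_erase_of_mem ha, pow_succ, Nat.sub_sub, Nat.add_comm 1]
      ring
    rw [h3]
    push_cast
    ring

theorem finrank_H (A : Finset (Fin n)) :
    Module.finrank ℝ (H A) = Fintype.card (derangements (Fin A.card)) := by
  have h := finrank_killed A (A := A) subset_rfl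
  rw [Finset.sum_powerset_apply_card (fun k => (-1) ^ k * ((A.card - k).factorial : ℤ))] at h
  rw [card_derangements_eq_numDerangements, Fintype.card_fin]
  have h' := numDerangements_sum A.card
  rw [← Nat.cast_inj (R := ℤ), h']
  refine h.trans (Finset.sum_congr rfl fun k hk => ?_)
  have hk : k ≤ A.card := Nat.lt_succ_iff.1 (Finset.mem_range.1 hk)
  -- Both sides are `A.card! / k!`; the right one is the form used in `numDerangements_sum`.
  have e : A.card.choose k * (A.card - k).factorial = (k + 1).ascFactorial (A.card - k) := by
    apply Nat.eq_of_mul_eq_mul_left k.factorial_pos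
    rw [Nat.factorial_mul_ascFactorial, Nat.add_sub_cancel' hk,
      ← Nat.choose_mul_factorial_mul_factorial hk]
    ring
  rw [← e]
  push_cast
  simp only [nsmul_eq_mul]
  ring

/-- The permutations with support `A` correspond to the derangements of `A`. -/
theorem sum_card_derangements (n : ℕ) :
    ∑ A : Finset (Fin n), Fintype.card (derangements (Fin A.card)) = n.factorial := by
  have h : Fintype.card (Equiv.Perm (Fin n)) = n.factorial := by
    rw [Fintype.card_perm, Fintype.card_fin]
  rw [← h, ← Finset.card_univ, Finset.card_eq_sum_card_fiberwise (f := fun σ : Equiv.Perm (Fin n) => σ.support)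
      (t := Finset.univ) (by simp)]
  refine Finset.sum_congr rfl fun A _ => ?_
  rw [← Fintype.card_subtype,
    card_derangements_invariant (α := Fin A.card) (β := {a // a ∈ A}) (by simp)]
  refine Fintype.card_congr ((derangements.subtypeEquiv (· ∈ A)).trans
    (Equiv.subtypeEquivRight fun σ => ?_))
  simp only [Finset.ext_iff, Equiv.Perm.mem_support, Function.mem_fixedPoints,
    Function.IsFixedPt]
  exact forall_congr' fun a => by tauto

/-! ### Marginals of embedded chains -/

/-- The marginal at the word `π`: the sum of the values at the permutations whose word contains
`π` as a (not necessarily contiguous) subword. -/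
noncomputable def marginal (π : List (Fin n)) : PermFun n →ₗ[ℝ] ℝ :=
  ∑ σ : Equiv.Perm (Fin n),
    Set.indicator {σ : Equiv.Perm (Fin n) | π.Sublist (permWord σ).1} (1 : PermFun n) σ •
      LinearMap.proj σ

theorem marginal_phi_single (π : List (Fin n)) (w : InjWord n) :
    marginal π (phi n (Pi.single w 1)) =
      Nat.card {σ : Equiv.Perm (Fin n) //
        w.1 <:+: (permWord σ).1 ∧ π.Sublist (permWord σ).1} := by
  classical
  rw [phi_single, Nat.card_eq_fintype_card, Fintype.card_subtype, Finset.card_filter]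
  simp only [marginal, LinearMap.sum_apply, LinearMap.smul_apply, LinearMap.proj_apply,
    Set.indicator_apply, Set.mem_ofPred_eq, Pi.one_apply, smul_eq_mul]
  push_cast
  refine Finset.sum_congr rfl fun σ _ => ?_
  split_ifs <;> simp_all

theorem permWord_injective : Function.Injective (permWord (n := n)) := by
  intro σ τ h
  have h : σ.symm = τ.symm := Equiv.coe_fn_injective (List.ofFn_injective (congrArg Subtype.val h))
  exact Equiv.symm_bijective.injective h

theorem permWord_perm (σ : Equiv.Perm (Fin n)) : (permWord σ).1.Perm (List.finRange n) := by
  rw [List.perm_ext_iff_of_nodup (permWord σ).2 (List.nodup_finRange n)]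
  intro a
  simp only [permWord, List.mem_ofFn, List.mem_finRange, iff_true]
  exact σ.symm.surjective a

theorem exists_permWord_eq {l : List (Fin n)} (hl : l.Perm (List.finRange n)) :
    ∃ σ : Equiv.Perm (Fin n), (permWord σ).1 = l := by
  have hlen : l.length = n := by simpa using hl.length_eq
  have hnd : l.Nodup := hl.nodup_iff.2 (List.nodup_finRange n)
  let f : Fin n → Fin n := fun i => l.get (i.cast hlen.symm)
  have hf : Function.Injective f := fun i j h => by
    simpa using hnd.injective_get h
  refine ⟨(Equiv.ofBijective f (Finite.injective_iff_bijective.1 hf)).symm, ?_⟩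
  apply List.ext_get
  · simp [permWord, hlen]
  · intro i h1 h2
    simp [permWord, f]

/-- If `p ++ w ++ s` has distinct letters and `w` is nonempty, then the word and its factor `w`
determine `p` and `s`. -/
theorem append_inj_of_nodup {α : Type*} {p q s t w : List α} (hw : w ≠ [])
    (hnd : (p ++ w ++ s).Nodup) (h : p ++ w ++ s = q ++ w ++ t) : p = q ∧ s = t := by
  obtain ⟨a, w, rfl⟩ := List.exists_cons_of_ne_nil hw
  have hlen : p.length = q.length := by
    have e1 : (p ++ a :: w ++ s)[p.length]? = some a := by simp
    have e2 : (p ++ a :: w ++ s)[q.length]? = some a := by rw [h]; simp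
    have hp : p.length < (p ++ a :: w ++ s).length := by simp
    exact (List.getElem?_inj hp hnd).1 (e1.trans e2.symm)
  rw [List.append_assoc, List.append_assoc] at h
  obtain ⟨rfl, h⟩ := List.append_inj h hlen
  exact ⟨rfl, (List.append_right_inj _).1 ((List.append_right_inj _).1 h)⟩

theorem erase_append_append {b : Fin n} {p w s : List (Fin n)} (hb : b ∈ w)
    (hnd : (p ++ w ++ s).Nodup) : (p ++ w ++ s).erase b = p ++ w.erase b ++ s := by
  have hp : b ∉ p := fun h =>
    (List.nodup_append.1 (List.nodup_append.1 hnd).1).2.2 b h b hb rfl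
  rw [List.erase_append, if_pos (by simp [hb]), List.erase_append, if_neg hp]

theorem sublist_append_iff_erase {b : Fin n} {π p w s : List (Fin n)} (hbπ : b ∉ π) (hb : b ∈ w)
    (hnd : (p ++ w ++ s).Nodup) :
    π.Sublist (p ++ w ++ s) ↔ π.Sublist (p ++ w.erase b ++ s) := by
  rw [← erase_append_append hb hnd]
  exact ⟨fun h => by simpa [List.erase_of_not_mem hbπ] using h.erase b,
    fun h => h.trans List.erase_sublist⟩

/-- For a letter `b` of `w` that is not in `π`, the number of permutations whose word contains
`w` as a factor and `π` as a subword depends on `w` only through `w.erase b`. -/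
theorem card_infix_sublist {b : Fin n} {π : List (Fin n)} (hbπ : b ∉ π) {w : InjWord n}
    (hb : b ∈ w.1) :
    Nat.card {σ : Equiv.Perm (Fin n) // w.1 <:+: (permWord σ).1 ∧ π.Sublist (permWord σ).1} =
      Nat.card {q : List (Fin n) × List (Fin n) //
        (q.1 ++ (b :: w.1.erase b) ++ q.2).Perm (List.finRange n) ∧
          π.Sublist (q.1 ++ w.1.erase b ++ q.2)} := by
  have hperm : ∀ p s, (p ++ (b :: w.1.erase b) ++ s).Perm (p ++ w.1 ++ s) := fun p s =>
    ((List.perm_cons_erase hb).symm.append_left p).append_right s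
  have hw : w.1 ≠ [] := List.ne_nil_of_mem hb
  symm
  refine Nat.card_congr (Equiv.ofBijective
    (fun q => ⟨(exists_permWord_eq ((hperm q.1.1 q.1.2).symm.trans q.2.1)).choose, ?_⟩)
    ⟨?_, ?_⟩)
  · have h := (hperm q.1.1 q.1.2).symm.trans q.2.1
    rw [(exists_permWord_eq h).choose_spec]
    exact ⟨⟨_, _, rfl⟩, (sublist_append_iff_erase hbπ hb
      (h.nodup_iff.2 (List.nodup_finRange n))).2 q.2.2⟩
  · intro q r hqr
    have hq := (hperm q.1.1 q.1.2).symm.trans q.2.1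
    have hr := (hperm r.1.1 r.1.2).symm.trans r.2.1
    have e := congrArg (fun σ => (permWord (Subtype.val σ)).1) hqr
    simp only at e
    rw [(exists_permWord_eq hq).choose_spec, (exists_permWord_eq hr).choose_spec] at e
    obtain ⟨h1, h2⟩ := append_inj_of_nodup hw (hq.nodup_iff.2 (List.nodup_finRange n)) e
    exact Subtype.ext (Prod.ext h1 h2)
  · rintro ⟨σ, ⟨p, s, hσ⟩, hπ⟩
    have h : (p ++ w.1 ++ s).Perm (List.finRange n) := hσ ▸ permWord_perm σ
    refine ⟨⟨(p, s), (hperm p s).trans h, ?_⟩, Subtype.ext (permWord_injective (Subtype.ext ?_))⟩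
    · rw [← hσ] at hπ
      exact (sublist_append_iff_erase hbπ hb (h.nodup_iff.2 (List.nodup_finRange n))).1 hπ
    · exact (exists_permWord_eq h).choose_spec.trans hσ

/-- On words of content `B`, the map `marginal π ∘ phi n` factors through `deletion b`, which kills
`x`. -/
theorem marginal_phi_eq_zero {B : Finset (Fin n)} {b : Fin n} (hbB : b ∈ B) {π : List (Fin n)}
    (hbπ : b ∉ π) {x : Chain n} (hx : x ∈ H B) : marginal π (phi n x) = 0 := by
  obtain ⟨hxB, hxk⟩ := mem_killed.1 hx
  -- The factor map: it counts the pairs of surroundings of `v`. Putting `b` at the head is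
  -- harmless, since the first condition ignores order and the second does not involve `b`.
  let F : Chain n →ₗ[ℝ] ℝ := (Pi.basisFun ℝ (InjWord n)).constr ℝ fun v =>
    (Nat.card {q : List (Fin n) × List (Fin n) //
        (q.1 ++ (b :: v.1) ++ q.2).Perm (List.finRange n) ∧
          π.Sublist (q.1 ++ v.1 ++ q.2)} : ℝ)
  have hF : ∀ v, F (Pi.single v 1) = (Nat.card {q : List (Fin n) × List (Fin n) //
        (q.1 ++ (b :: v.1) ++ q.2).Perm (List.finRange n) ∧
          π.Sublist (q.1 ++ v.1 ++ q.2)} : ℝ) := fun v => by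
    rw [← Pi.basisFun_apply, Module.Basis.constr_basis]
  have : (marginal π ∘ₗ phi n) x = (F ∘ₗ deletion b) x := by
    refine map_eq_map_of_mem_chainsOn _ _ hxB fun w hw => ?_
    have hb : b ∈ w.1 := by simpa [← hw, content] using hbB
    rw [LinearMap.comp_apply, LinearMap.comp_apply, deletion_single, hF, marginal_phi_single,
      card_infix_sublist hbπ hb]
    rfl
  rw [LinearMap.comp_apply, LinearMap.comp_apply, hxk b hbB, map_zero] at this
  exact this

/-- A sublist of a list without repetition is recovered by filtering that list by the sublist's
content. -/
theorem eq_of_sublist_of_nodup {l u v : List (Fin n)} (hl : l.Nodup) (hu : u.Sublist l)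
    (hv : v.Sublist l) (h : u.toFinset = v.toFinset) : u = v := by
  have key : ∀ {u : List (Fin n)}, u.Sublist l → u = l.filter (· ∈ u.toFinset) := by
    intro u hu
    refine List.Sublist.eq_of_length_le ?_ ?_
    · have := hu.filter (· ∈ u.toFinset)
      rwa [List.filter_eq_self.2 (by simp)] at this
    · rw [← List.toFinset_card_of_nodup (hl.filter _),
        ← List.toFinset_card_of_nodup (hl.sublist hu)]
      exact Finset.card_le_card fun a => by simp
  rw [key hu, key hv, h]

/-- A permutation word cannot contain two different words of the same content as subwords, so only
the coordinate at `π` contributes. The constant counts the permutations having `π` as a factor. -/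
theorem marginal_phi_of_mem_chainsOn (π : InjWord n) :
    ∃ c : ℝ, c ≠ 0 ∧ ∀ x ∈ chainsOn (content π), marginal π.1 (phi n x) = c * x π := by
  refine ⟨marginal π.1 (phi n (Pi.single π 1)), ?_, fun x hx => ?_⟩
  · rw [marginal_phi_single, Nat.cast_ne_zero, Nat.card_ne_zero]
    refine ⟨?_, inferInstance⟩
    -- Such a permutation exists: follow `π` by the missing letters.
    have h : (π.1 ++ (List.finRange n).filter (· ∉ π.1)).Perm (List.finRange n) := by
      refine (List.perm_ext_iff_of_nodup ?_ (List.nodup_finRange n)).2 fun a => ?_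
      · refine List.nodup_append.2 ⟨π.2, (List.nodup_finRange n).filter _, ?_⟩
        rintro a ha b hb rfl
        simp [ha] at hb
      · simp [em]
    obtain ⟨σ, hσ⟩ := exists_permWord_eq h
    have hi : π.1 <:+: (permWord σ).1 := ⟨[], _, by rw [hσ]; rfl⟩
    exact ⟨⟨σ, hi, hi.sublist⟩⟩
  · refine map_eq_map_of_mem_chainsOn (marginal π.1 ∘ₗ phi n)
      (marginal π.1 (phi n (Pi.single π 1)) • LinearMap.proj π) hx fun w hw => ?_
    by_cases h : w = π
    · simp [h]
    · have : IsEmpty {σ : Equiv.Perm (Fin n) //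
          w.1 <:+: (permWord σ).1 ∧ π.1.Sublist (permWord σ).1} :=
        ⟨fun σ => h (Subtype.ext
          (eq_of_sublist_of_nodup (permWord σ.1).2 σ.2.1.sublist σ.2.2 hw))⟩
      rw [LinearMap.comp_apply, marginal_phi_single, Nat.card_of_isEmpty]
      simp [Ne.symm h]

theorem eq_zero_of_marginal_eq_zero {A : Finset (Fin n)} {x : Chain n} (hx : x ∈ chainsOn A)
    (h : ∀ π : InjWord n, content π = A → marginal π.1 (phi n x) = 0) : x = 0 := by
  funext π
  by_cases hπ : content π = A
  · obtain ⟨c, hc, hcx⟩ := marginal_phi_of_mem_chainsOn π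
    have := hcx x (hπ ▸ hx)
    rw [h π hπ] at this
    exact (mul_eq_zero.1 this.symm).resolve_left hc
  · exact hx π hπ

/-! ### Independence and dimension count -/

theorem phi_injOn_chainsOn (A : Finset (Fin n)) :
    Set.InjOn (phi n) (chainsOn A : Set (Chain n)) := by
  intro x hx y hy h
  refine sub_eq_zero.1 (eq_zero_of_marginal_eq_zero (Submodule.sub_mem _ hx hy) fun π _ => ?_)
  rw [map_sub, h, sub_self, map_zero]

theorem finrank_W (A : Finset (Fin n)) :
    Module.finrank ℝ (W A) = Fintype.card (derangements (Fin A.card)) := by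
  rw [← finrank_H A, W, ← LinearMap.range_domRestrict]
  exact LinearMap.finrank_range_of_inj
    ((phi_injOn_chainsOn A).mono fun _ hx => (mem_killed.1 hx).1).injective

theorem iSupIndep_W (n : ℕ) : iSupIndep (W (n := n)) := by
  rw [iSupIndep_iff_finsetSum_eq_zero_imp_eq_zero]
  intro s v hv hsum A
  induction A using Finset.strongInduction with
  | H A ih =>
    intro hA
    obtain ⟨x, hx, hxv⟩ := hv A hA
    suffices x = 0 by rw [← hxv, this, map_zero]
    refine eq_zero_of_marginal_eq_zero (mem_killed.1 hx).1 fun π hπ => ?_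
    have h := congrArg (marginal π.1) hsum
    rw [map_sum, map_zero, Finset.sum_eq_single_of_mem A hA] at h
    · rw [hxv, h]
    · intro B hB hBA
      -- Proper subsets of `A` are handled by induction; any other `B` has a letter outside `π`, so
      -- the marginal kills its term.
      by_cases hsub : B ⊆ A
      · rw [ih B (hsub.ssubset_of_ne hBA) hB, map_zero]
      · obtain ⟨b, hb, hbA⟩ := Finset.not_subset.1 hsub
        obtain ⟨y, hy, hyv⟩ := hv B hB
        rw [← hyv]
        refine marginal_phi_eq_zero hb (fun hbπ => hbA ?_) hy
        simpa [← hπ, content] using hbπ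

/-- The empty word is a factor of every word, so its image is the constant 1; both spaces have
dimension 1. -/
theorem W_empty (n : ℕ) : W (∅ : Finset (Fin n)) = V0 n := by
  have h1 : (1 : PermFun n) ∈ W (∅ : Finset (Fin n)) := by
    have h := single_mem_chainsOn (⟨[], List.nodup_nil⟩ : InjWord n)
    refine ⟨Pi.single ⟨[], List.nodup_nil⟩ 1, mem_killed.2 ⟨h, by simp⟩, ?_⟩
    rw [phi_single]
    simp
  refine (Submodule.eq_of_le_of_finrank_eq ?_ ?_).symm
  · exact (Submodule.span_singleton_le_iff_mem _ _).2 h1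
  · rw [finrank_W, V0, finrank_span_singleton one_ne_zero]
    rw [card_derangements_eq_numDerangements, Fintype.card_fin, Finset.card_empty,
      numDerangements_zero]

/-- The set of letters underlying a component: the constants belong to the empty set. -/
def componentSet (n : ℕ) : Option {A : Finset (Fin n) // 2 ≤ A.card} → Finset (Fin n)
  | none => ∅
  | some A => A.1

theorem componentSet_injective (n : ℕ) : Function.Injective (componentSet n) := by
  rintro (_ | ⟨A, hA⟩) (_ | ⟨B, hB⟩) h
  · rfl
  · simp only [componentSet] at h
    subst h
    simp at hB
  · simp only [componentSet] at h
    subst h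
    simp at hA
  · simp only [componentSet] at h
    subst h
    rfl

theorem component_eq (n : ℕ) : component n = W ∘ componentSet n := by
  funext i
  cases i with
  | none => exact (W_empty n).symm
  | some A => rfl

theorem sum_finrank_component (n : ℕ) :
    ∑ i, Module.finrank ℝ (component n i) = n.factorial := by
  rw [← sum_card_derangements n, component_eq]
  simp only [Function.comp_apply, finrank_W]
  refine Finset.sum_of_injOn (componentSet n) (componentSet_injective n).injOn (by simp)
    (fun A _ hA => ?_) fun _ _ => rfl
  -- The sets that index no component are singletons, and a single point has no derangement.
  have hA1 : A.card = 1 := by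
    by_contra h1
    refine hA ?_
    rcases A.eq_empty_or_nonempty with rfl | hne
    · exact ⟨none, by simp, rfl⟩
    · have := hne.card_pos
      exact ⟨some ⟨A, by omega⟩, by simp, rfl⟩
  rw [card_derangements_eq_numDerangements, Fintype.card_fin, hA1, numDerangements_one]

theorem isInternal_component (n : ℕ) : DirectSum.IsInternal (component n) := by
  have hind : iSupIndep (component n) := by
    rw [component_eq]
    exact (iSupIndep_W n).comp (componentSet_injective n)
  have hinj : Function.Injective (DirectSum.coeLinearMap (component n)) :=
    hind.dfinsupp_lsum_injective
  suffices Function.Surjective (DirectSum.coeLinearMap (component n)) from ⟨hinj, this⟩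
  refine LinearMap.range_eq_top.1 (Submodule.eq_top_of_finrank_eq ?_)
  rw [LinearMap.finrank_range_of_inj hinj, Module.finrank_directSum, sum_finrank_component,
    Module.finrank_fintype_fun_eq_card, Fintype.card_perm, Fintype.card_fin]

end MRA

theorem mainTheorem1 (n : ℕ) :
    DirectSum.IsInternal (MRA.component n) ∧
      ∀ A : Finset (Fin n), 2 ≤ A.card →
        Module.finrank ℝ (MRA.W A) = Fintype.card (derangements (Fin A.card)) ∧
        Submodule.map (MRA.phi n) (MRA.H A) = MRA.W A ∧
        Set.InjOn (MRA.phi n) (MRA.H A : Set (MRA.Chain n)) :=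
  ⟨MRA.isInternal_component n, fun A _ => ⟨MRA.finrank_W A, rfl,
    (MRA.phi_injOn_chainsOn A).mono fun _ hx => (MRA.mem_killed.1 hx).1⟩⟩
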